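/- Let $p>2$ be a prime, $K$ an algebraically closed field of characteristic $p$ and $v:K^*\to\mathbb{R}$ a nontrivial valuation. For $m\ge 1$ let $H_{p,m}\subseteq\mathbb{R}^{m+1}$ be the set of tropical polynomials $f=\bigoplus_{i=0}^m a_ix^i$ of degree $m$ having $0$ as a tropical double root, that is, the closure of the set of vectors $(v(A_0),\dots,v(A_m))$ where $F=\sum_{i=0}^m A_iX^i\in K[X]$ has all $A_i\neq 0$ and there is $B\in K^*$ with $v(B)=0$ and $F(B)=F'(B)=0$. A facet (maximal cell) of $H_{p,m}$ is the closure of a connected component of the set of points of $H_{p,m}$ near which $H_{p,m}$ coincides with an affine subspace. For monomials $i,j,k,l\in\{0,\dots,m\}$ let $C_{i,j,k}$ be the set of $a\in\mathbb{R}^{m+1}$ such that the minimum of all $a_r$ is attained at $i$, $j$ and $k$ (and possibly elsewhere), and let $C_{ij,kl}$ be the set of $a$ such that the minimum of all $a_r$ is attained at $i$ and $j$, and the minimum of the $a_r$ with $r\not\equiv i \pmod p$ is attained at $k$ and $l$ (in each case possibly elsewhere too). A facet is of * type I if it equals $C_{i,j,k}$ for some $i,j,k$ that are pairwise incongruent mod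 $p$; * type II if it equals $C_{ij,kl}$ for some $i\neq j$, $i\equiv j$, and $k,l\not\equiv i$, $k\not\equiv l \pmod p$; * type III if it equals $C_{ij,kl}\cup C_{kl,ij}$ for some $i\ne j$, $k\neq l$, $i\equiv j\not\equiv k\equiv l \pmod p$. Then for every $n\ge 1$ each facet of $H_{p,pn-1}$ is of type I, II or III, and $H_{p,pn-1}$ has exactly 1. $\binom{p}{3}n^3$ facets of type I, 2. $p\,n^2\binom{n}{2}\binom{p-1}{2}$ facets of type II, 3. $\binom{p}{2}\binom{n}{2}^2$ facets of type III. Moreover, for fixed $p$ the number of facets of $H_{p,m}$ is $O(m^4)$: there is a constant $C$ depending only on $p$ (not on $K$, $v$ or $m$) such that $H_{p,m}$ has at most $C\,m^4$ facets for all $m\ge 1$. -/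

import Mathlib

open Polynomial Topology

universe u

/-- The tropical polynomials of degree `m` with `0` as a tropical double root, as a subset of
`ℝ^(m+1)` (one coordinate for each coefficient): the closure of the set of all vectors
`(v (coeff F 0), …, v (coeff F m))` where `F` is a polynomial of degree `m` over `K`, with all
coefficients non-zero, that has a double root `B` with `v B = 0`. Here `v` is an additive real
valuation. The condition `v (F.coeff i) = a i` with `a i` real forces `F.coeff i ≠ 0`. -/
def tropDoubleRoot {K : Type u} [Field K] (v : AddValuation K (WithTop ℝ)) (m : ℕ) :
    Set (Fin (m + 1) → ℝ) :=
  closure {a | ∃ F : K[X], F.natDegree = m ∧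
    (∀ i : Fin (m + 1), v (F.coeff i) = ((a i : ℝ) : WithTop ℝ)) ∧
    ∃ B : K, v B = 0 ∧ F.IsRoot B ∧ (derivative F).IsRoot B}

/-- The points of `S` near which `S` coincides with an affine subspace. -/
def regularPoints {N : ℕ} (S : Set (Fin N → ℝ)) : Set (Fin N → ℝ) :=
  {x | x ∈ S ∧ ∃ W : Submodule ℝ (Fin N → ℝ), ∀ᶠ y in 𝓝 x, y ∈ S ↔ y - x ∈ W}

/-- The facets (maximal cells, in the coarsest subdivision) of the support `S` of a polyhedral
complex: the closures of the connected components of the set of regular points of `S`. -/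
def IsFacet {N : ℕ} (S F : Set (Fin N → ℝ)) : Prop :=
  ∃ x ∈ regularPoints S, F = closure (connectedComponentIn (regularPoints S) x)

/-- Tropical polynomials whose least coefficient is attained at the monomials `i`, `j`, `k`. -/
def tripleCell {m : ℕ} (i j k : Fin (m + 1)) : Set (Fin (m + 1) → ℝ) :=
  {a | ∀ r, a i ≤ a r ∧ a j ≤ a r ∧ a k ≤ a r}

/-- Tropical polynomials whose least coefficient is attained at the monomials `i`, `j` and, once
the monomials congruent to `i` modulo `p` are removed, at `k`, `l`. -/
def pairCell (p : ℕ) {m : ℕ} (i j k l : Fin (m + 1)) : Set (Fin (m + 1) → ℝ) :=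
  {a | (∀ r, a i ≤ a r ∧ a j ≤ a r) ∧
    ∀ r : Fin (m + 1), ¬ (r : ℕ) ≡ i [MOD p] → a k ≤ a r ∧ a l ≤ a r}

/-- The cells `{i, j, k}`, with three different residues. -/
def IsTypeI (p : ℕ) {m : ℕ} (F : Set (Fin (m + 1) → ℝ)) : Prop :=
  ∃ i j k : Fin (m + 1), ¬ (i : ℕ) ≡ j [MOD p] ∧ ¬ (i : ℕ) ≡ k [MOD p] ∧
    ¬ (j : ℕ) ≡ k [MOD p] ∧ F = tripleCell i j k

/-- The cells `[{i, j}, {k, l}]`, with `i ≡ j`, `k ≢ l` and `k`, `l` not congruent to `i`. -/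
def IsTypeII (p : ℕ) {m : ℕ} (F : Set (Fin (m + 1) → ℝ)) : Prop :=
  ∃ i j k l : Fin (m + 1), i ≠ j ∧ (i : ℕ) ≡ j [MOD p] ∧ ¬ (k : ℕ) ≡ i [MOD p] ∧
    ¬ (l : ℕ) ≡ i [MOD p] ∧ ¬ (k : ℕ) ≡ l [MOD p] ∧ F = pairCell p i j k l

/-- The cells `{{i, j}, {k, l}}`, with `i ≡ j`, `k ≡ l` and `i ≢ k`. Either pair may be the one
where the least coefficient is attained. -/
def IsTypeIII (p : ℕ) {m : ℕ} (F : Set (Fin (m + 1) → ℝ)) : Prop :=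
  ∃ i j k l : Fin (m + 1), i ≠ j ∧ k ≠ l ∧ (i : ℕ) ≡ j [MOD p] ∧ (k : ℕ) ≡ l [MOD p] ∧
    ¬ (i : ℕ) ≡ k [MOD p] ∧ F = pairCell p i j k l ∪ pairCell p k l i j

/-! Since `v B = 0`, replacing `X` by `B X` keeps all coefficient valuations, so the double root may
be placed at `1`. The set is then the closure of the valuation vectors of the linear space `∑ x_i =
0`, `∑ i x_i = 0`, which is defined over the prime field. For each residue `c`, the combination `∑
(i - c) x_i = 0` involves only exponents outside the class of `c`, and its coefficients there have
valuation `0`. Hence the minimum of the valuations outside each class is attained twice, which is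
`minTwice (residue p)`.

Conversely, `minTwice` is a union of polyhedral cells given by `a i = a j`, `a k = a l` and
inequalities. On an open cell the equation for the class of `i` does not contain `x_i`, and the one
for the class of `k` does not contain `x_k`. They can therefore be solved separately for `x_k` and
`x_i` without changing valuations. The value group is dense in `ℝ`, so the closure contains every
cell (`tropDoubleRoot_eq_minTwice`).

One family of quadruples treats all types: `j = l` gives type I, while `ρ i = ρ j` gives type II or
III according to whether `ρ k` and `ρ l` differ. Each open cell is relatively open and closed in the
set of regular points, so the facets are exactly the closed cells (`isFacet_minTwice_iff`). A test
point in each cell recovers its indices up to the evident symmetries, and counting normalized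
indices gives the formulas. -/

/-! ### Cells of the tropical linear space -/

section Cells

variable {N : ℕ} {κ : Type*}

/-- The vectors whose least coordinate outside of any given fibre of `ρ` is attained twice. -/
def minTwice (ρ : Fin N → κ) : Set (Fin N → ℝ) :=
  {a | ∀ c, ∃ i j, i ≠ j ∧ ρ i ≠ c ∧ ρ j ≠ c ∧ ∀ r, ρ r ≠ c → a i ≤ a r ∧ a j ≤ a r}

/-- The pairs of coordinates compared in the cell with equations `a i = a j` and `a k = a l`. -/
def Compared (ρ : Fin N → κ) (i j k l s t : Fin N) : Prop :=
  ((s = i ∨ s = j) ∧ t ≠ i ∧ t ≠ j ∧ ρ t ≠ ρ k) ∨ ((s = k ∨ s = l) ∧ t ≠ k ∧ t ≠ l ∧ ρ t ≠ ρ i)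

/-- A closed cell of `minTwice ρ`. -/
def closedCell (ρ : Fin N → κ) (i j k l : Fin N) : Set (Fin N → ℝ) :=
  {a | a i = a j ∧ a k = a l ∧ ∀ s t, Compared ρ i j k l s t → a s ≤ a t}

/-- The relative interior of `closedCell ρ i j k l`. -/
def openCell (ρ : Fin N → κ) (i j k l : Fin N) : Set (Fin N → ℝ) :=
  {a | a i = a j ∧ a k = a l ∧ ∀ s t, Compared ρ i j k l s t → a s < a t}

/-- An open set that meets `minTwice ρ` in `openCell ρ i j k l`. -/
def cellNhd (ρ : Fin N → κ) (i j k l : Fin N) : Set (Fin N → ℝ) :=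
  {a | ∀ s t, Compared ρ i j k l s t → a s < a t}

/-- The index quadruples of the maximal cells: `j = l` for three different residues, and
`ρ i = ρ j` for two pairs. -/
structure Admissible (ρ : Fin N → κ) (i j k l : Fin N) : Prop where
  ik : ρ i ≠ ρ k
  jk : ρ j ≠ ρ k
  li : ρ l ≠ ρ i
  ij : i ≠ j
  kl : k ≠ l
  or : j = l ∨ ρ i = ρ j

variable {ρ : Fin N → κ} {i j k l : Fin N}

lemma openCell_subset_closedCell : openCell ρ i j k l ⊆ closedCell ρ i j k l :=
  fun _ h => ⟨h.1, h.2.1, fun s t hst => (h.2.2 s t hst).le⟩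

lemma isOpen_cellNhd : IsOpen (cellNhd ρ i j k l) := by
  have : cellNhd ρ i j k l =
      ⋂ s, ⋂ t, ⋂ _ : Compared ρ i j k l s t, {a : Fin N → ℝ | a s < a t} := by
    ext a; simp [cellNhd]
  rw [this]
  exact isOpen_iInter_of_finite fun s => isOpen_iInter_of_finite fun t =>
    isOpen_iInter_of_finite fun _ => isOpen_lt (by fun_prop) (by fun_prop)

lemma isClosed_closedCell : IsClosed (closedCell ρ i j k l) := by
  have : closedCell ρ i j k l = {a | a i = a j} ∩ {a | a k = a l} ∩
      ⋂ s, ⋂ t, ⋂ _ : Compared ρ i j k l s t, {a : Fin N → ℝ | a s ≤ a t} := by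
    ext a; simp [closedCell, and_assoc]
  rw [this]
  refine ((isClosed_eq (by fun_prop) (by fun_prop)).inter
    (isClosed_eq (by fun_prop) (by fun_prop))).inter ?_
  exact isClosed_iInter fun s => isClosed_iInter fun t =>
    isClosed_iInter fun _ => isClosed_le (by fun_prop) (by fun_prop)

lemma add_smul_mem_openCell {x y : Fin N → ℝ} (hx : x ∈ closedCell ρ i j k l)
    (hy : y ∈ openCell ρ i j k l) {s t : ℝ} (hs : 0 ≤ s) (ht : 0 < t) :
    s • x + t • y ∈ openCell ρ i j k l := by
  refine ⟨?_, ?_, fun q r hqr => ?_⟩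
  · simp [hx.1, hy.1]
  · simp [hx.2.1, hy.2.1]
  · have h1 := mul_le_mul_of_nonneg_left (hx.2.2 q r hqr) hs
    have h2 := mul_lt_mul_of_pos_left (hy.2.2 q r hqr) ht
    simpa using add_lt_add_of_le_of_lt h1 h2

lemma convex_openCell : Convex ℝ (openCell ρ i j k l) := by
  intro x hx y hy s t hs ht hst
  rcases ht.eq_or_lt with rfl | ht
  · obtain rfl : s = 1 := by linarith
    simpa using hx
  · exact add_smul_mem_openCell (openCell_subset_closedCell hx) hy hs ht

lemma closure_openCell (hne : (openCell ρ i j k l).Nonempty) :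
    closure (openCell ρ i j k l) = closedCell ρ i j k l := by
  refine (closure_minimal openCell_subset_closedCell isClosed_closedCell).antisymm fun x hx => ?_
  obtain ⟨y, hy⟩ := hne
  have hc : Filter.Tendsto (fun t : ℝ => (1 - t) • x + t • y) (𝓝[>] 0) (𝓝 x) := by
    have : Continuous (fun t : ℝ => (1 - t) • x + t • y) := by fun_prop
    simpa using (this.tendsto 0).mono_left nhdsWithin_le_nhds
  refine mem_closure_of_tendsto hc ?_
  filter_upwards [Ioo_mem_nhdsGT (zero_lt_one' ℝ)] with t ht
  exact add_smul_mem_openCell hx hy (by linarith [ht.2]) ht.1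

lemma closedCell_subset_minTwice (h : Admissible ρ i j k l) :
    closedCell ρ i j k l ⊆ minTwice ρ := by
  rintro a ⟨h1, h2, h3⟩ c
  obtain ⟨ik, jk, li, ij, kl, hor⟩ := h
  have hi : ∀ r, ρ r ≠ ρ k → a i ≤ a r := fun r hr => by
    have := h3 i r; unfold Compared at this; grind
  have hk : ∀ r, ρ r ≠ ρ i → a k ≤ a r := fun r hr => by
    have := h3 k r; unfold Compared at this; grind
  by_cases hci : c = ρ i
  · exact ⟨k, l, kl, by grind, by grind, fun r hr => by grind⟩
  by_cases hck : c = ρ k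
  · exact ⟨i, j, ij, by grind, by grind, fun r hr => by grind⟩
  -- For a third class `c`, the smaller of the two pairs realizes the minimum; in the triple case
  -- all the values agree.
  have hmin : ∀ r, min (a i) (a k) ≤ a r := fun r => by
    by_cases hr : ρ r = ρ k
    · exact (min_le_right _ _).trans (hk r (by grind))
    · exact (min_le_left _ _).trans (hi r hr)
  rcases hor with rfl | hij
  · exact ⟨i, k, by grind, by grind, by grind, fun r hr => by grind⟩
  · rcases le_total (a i) (a k) with hle | hle
    · exact ⟨i, j, ij, by grind, by grind, fun r hr => by grind⟩
    · by_cases hkl : ρ l = ρ k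
      · exact ⟨k, l, kl, by grind, by grind, fun r hr => by grind⟩
      · exact ⟨i, j, ij, by grind, by grind, fun r hr => by grind⟩

lemma not_mem_minTwice {a : Fin N → ℝ} (c : κ) (t : Fin N)
    (h : ∀ s, ρ s ≠ c → s ≠ t → a t < a s) (ht : ρ t ≠ c) : a ∉ minTwice ρ := by
  intro ha
  obtain ⟨i, j, hij, hi, hj, hr⟩ := ha c
  have := hr t ht
  by_cases hit : i = t
  · exact absurd (h j hj (by grind)) (by linarith)
  · exact absurd (h i hi hit) (by linarith)

/-- Under the strict inequalities only `i`, `j` can be minimal outside the class of `k`, and only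
`k`, `l` outside the class of `i`; attaining each minimum twice forces both equations. -/
lemma minTwice_inter_cellNhd (h : Admissible ρ i j k l) :
    minTwice ρ ∩ cellNhd ρ i j k l = openCell ρ i j k l := by
  refine subset_antisymm ?_ fun a ha =>
    ⟨closedCell_subset_minTwice h (openCell_subset_closedCell ha), ha.2.2⟩
  rintro a ⟨ha, hn⟩
  obtain ⟨ik, jk, li, ij, kl, hor⟩ := h
  refine ⟨?_, ?_, hn⟩
  · have h1 : ∀ r, ρ r ≠ ρ k → r ≠ i → r ≠ j → a i < a r ∧ a j < a r := fun r _ _ _ =>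
      ⟨hn i r (by unfold Compared; grind), hn j r (by unfold Compared; grind)⟩
    by_contra hne
    rcases lt_or_gt_of_ne hne with hlt | hlt
    · exact not_mem_minTwice (ρ k) i (fun s _ _ => by grind) ik ha
    · exact not_mem_minTwice (ρ k) j (fun s _ _ => by grind) jk ha
  · have h1 : ∀ r, ρ r ≠ ρ i → r ≠ k → r ≠ l → a k < a r ∧ a l < a r := fun r _ _ _ =>
      ⟨hn k r (by unfold Compared; grind), hn l r (by unfold Compared; grind)⟩
    by_contra hne
    rcases lt_or_gt_of_ne hne with hlt | hlt
    · exact not_mem_minTwice (ρ i) k (fun s _ _ => by grind) ik.symm ha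
    · exact not_mem_minTwice (ρ i) l (fun s _ _ => by grind) li ha

/-! ### Open cells as components of the regular locus. -/

lemma openCell_subset_regularPoints (h : Admissible ρ i j k l) :
    openCell ρ i j k l ⊆ regularPoints (minTwice ρ) := by
  intro x hx
  have hx' := hx
  rw [← minTwice_inter_cellNhd h] at hx'
  refine ⟨hx'.1, LinearMap.ker (LinearMap.proj (R := ℝ) (φ := fun _ : Fin N => ℝ) i -
    LinearMap.proj j) ⊓ LinearMap.ker (LinearMap.proj (R := ℝ) (φ := fun _ : Fin N => ℝ) k -
    LinearMap.proj l), ?_⟩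
  filter_upwards [isOpen_cellNhd.mem_nhds hx'.2] with y hy
  have : y ∈ minTwice ρ ↔ y ∈ openCell ρ i j k l := by
    rw [← minTwice_inter_cellNhd h]; exact ⟨fun h => ⟨h, hy⟩, fun h => h.1⟩
  rw [this]
  have h1 := hx.1
  have h2 := hx.2.1
  simp only [Submodule.mem_inf, LinearMap.mem_ker, LinearMap.sub_apply, LinearMap.proj_apply,
    Pi.sub_apply]
  constructor
  · intro h'
    have h3 := h'.1
    have h4 := h'.2.1
    constructor <;> linarith
  · rintro ⟨h3, h4⟩
    exact ⟨by linarith, by linarith, hy⟩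

/-- Near a regular point the set is a translate of a linear subspace, so its directions are closed
under negation. This is the tool for showing that boundary points of cells are singular. -/
lemma reflect_mem_of_mem_regularPoints {S : Set (Fin N → ℝ)} {x : Fin N → ℝ}
    (hx : x ∈ regularPoints S) (w : Fin N → ℝ) (h : ∀ᶠ t in 𝓝[>] (0 : ℝ), x + t • w ∈ S) :
    ∀ᶠ t in 𝓝[>] (0 : ℝ), x - t • w ∈ S := by
  obtain ⟨-, W, hW⟩ := hx
  have h1 : Filter.Tendsto (fun t : ℝ => x + t • w) (𝓝[>] 0) (𝓝 x) := by
    have : Continuous (fun t : ℝ => x + t • w) := by fun_prop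
    simpa using (this.tendsto 0).mono_left nhdsWithin_le_nhds
  have h2 : Filter.Tendsto (fun t : ℝ => x - t • w) (𝓝[>] 0) (𝓝 x) := by
    have : Continuous (fun t : ℝ => x - t • w) := by fun_prop
    simpa using (this.tendsto 0).mono_left nhdsWithin_le_nhds
  have hw : w ∈ W := by
    obtain ⟨t, ht, ht1, ht0⟩ := (h.and ((h1.eventually hW).and self_mem_nhdsWithin)).exists
    have := ht1.1 ht
    rw [add_sub_cancel_left] at this
    exact (W.smul_mem_iff (ne_of_gt ht0)).1 this
  filter_upwards [h2.eventually hW] with t ht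
  rw [ht, sub_sub_cancel_left]
  exact W.neg_mem (W.smul_mem t hw)

/-- If a defining inequality is an equality, raising the larger side stays in the closed cell, while
the reflected motion creates a unique minimum outside some class. -/
lemma regularPoints_inter_closedCell_subset (h : Admissible ρ i j k l) :
    regularPoints (minTwice ρ) ∩ closedCell ρ i j k l ⊆ openCell ρ i j k l := by
  rintro x ⟨hx, hc⟩
  have hT := closedCell_subset_minTwice h
  obtain ⟨ik, jk, li, ij, kl, hor⟩ := h
  have hi : ∀ r, ρ r ≠ ρ k → x i ≤ x r := fun r hr => by
    have := hc.2.2 i r; have := hc.1; unfold Compared at *; grind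
  have hk : ∀ r, ρ r ≠ ρ i → x k ≤ x r := fun r hr => by
    have := hc.2.2 k r; have := hc.2.1; unfold Compared at *; grind
  obtain ⟨h1, h2, h3⟩ := hc
  have key : ∀ t, t ≠ i → t ≠ j → t ≠ k → t ≠ l →
      (ρ t ≠ ρ k → x i < x t) ∧ (ρ t ≠ ρ i → x k < x t) := by
    intro t ti tj tk tl
    have hup : ∀ᶠ e in 𝓝[>] (0 : ℝ), x + e • (Pi.single t 1 : Fin N → ℝ) ∈ minTwice ρ := by
      filter_upwards [self_mem_nhdsWithin] with e he
      have he : 0 < e := he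
      refine hT ⟨by simp [ti.symm, tj.symm, h1], by simp [tk.symm, tl.symm, h2], fun s r hsr => ?_⟩
      have hst : s ≠ t := by rcases hsr with h | h <;> grind
      have := h3 s r hsr
      by_cases hrt : r = t
      · subst hrt; simp [hst]; linarith
      · simpa [hst, hrt] using this
    obtain ⟨e, he, he0⟩ :=
      ((reflect_mem_of_mem_regularPoints hx _ hup).and self_mem_nhdsWithin).exists
    have he0 : 0 < e := he0
    constructor
    · intro htk
      refine (hi t htk).lt_of_ne fun heq => not_mem_minTwice (ρ k) t (fun s hs hst => ?_) htk he
      have := hi s hs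
      simp [hst]; linarith
    · intro hti
      refine (hk t hti).lt_of_ne fun heq => not_mem_minTwice (ρ i) t (fun s hs hst => ?_) hti he
      have := hk s hs
      simp [hst]; linarith
  -- In type II the coordinate `l` is tied to `k`, so both are raised together. The reflected motion
  -- makes `l` the unique minimum outside the class of `k`.
  have hil : ρ k ≠ ρ l → ρ i = ρ j → x i < x l := by
    intro hkl hij
    refine (hi l hkl.symm).lt_of_ne fun heq => ?_
    have hup : ∀ᶠ e in 𝓝[>] (0 : ℝ),
        x + e • (Pi.single k 1 + Pi.single l 1 : Fin N → ℝ) ∈ minTwice ρ := by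
      have hlt : ∀ᶠ e in 𝓝[>] (0 : ℝ), ∀ r, r ≠ k → r ≠ l → ρ r ≠ ρ i → x k + e < x r := by
        refine Filter.eventually_all.2 fun r => ?_
        by_cases hr : r ≠ k ∧ r ≠ l ∧ ρ r ≠ ρ i
        · have h4 := (key r (by grind) (by grind) hr.1 hr.2.1).2 hr.2.2
          filter_upwards [Ioo_mem_nhdsGT (sub_pos.2 h4)] with e he _ _ _
          linarith [he.2]
        · exact Filter.Eventually.of_forall fun e => by grind
      filter_upwards [self_mem_nhdsWithin, hlt] with e he hlt
      have he : 0 < e := he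
      have e1 : ∀ r, r = k ∨ r = l → (x + e • (Pi.single k 1 + Pi.single l 1 : Fin N → ℝ)) r
          = x r + e := by
        rintro r (rfl | rfl)
        · simp [kl]
        · simp [kl.symm]
      have e2 : ∀ r, r ≠ k → r ≠ l → (x + e • (Pi.single k 1 + Pi.single l 1 : Fin N → ℝ)) r
          = x r := fun r hk hl => by simp [hk, hl]
      generalize (x + e • (Pi.single k 1 + Pi.single l 1 : Fin N → ℝ)) = y at e1 e2
      refine hT ⟨?_, ?_, fun s r hsr => ?_⟩
      · rw [e2 i (by grind) (by grind), e2 j (by grind) (by grind), h1]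
      · rw [e1 k (by grind), e1 l (by grind), h2]
      · have h5 := h3 s r hsr
        rcases hsr with hsr | hsr
        · rw [e2 s (by grind) (by grind)]
          by_cases hr : r = k ∨ r = l
          · rw [e1 r hr]; linarith
          · rw [e2 r (by grind) (by grind)]; exact h5
        · rw [e1 s hsr.1, e2 r (by grind) (by grind)]
          have := hlt r (by grind) (by grind) (by grind)
          grind
    obtain ⟨e, he, he0⟩ :=
      ((reflect_mem_of_mem_regularPoints hx _ hup).and self_mem_nhdsWithin).exists
    have he0 : 0 < e := he0
    refine not_mem_minTwice (ρ k) l (fun s hs hst => ?_) hkl.symm he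
    have := hi s hs
    have hsk : s ≠ k := by grind
    simp [hst, hsk, kl.symm]; linarith
  refine ⟨h1, h2, fun s t hst => ?_⟩
  rcases hst with ⟨hs, ti, tj, htk⟩ | ⟨hs, tk, tl, hti⟩
  · by_cases htl : t = l
    · grind
    · have := (key t ti tj (by grind) htl).1 htk
      grind
  · by_cases htj : t = j
    · grind
    · have := (key t (by grind) htj tk tl).2 hti
      grind

/-- Within the regular points the open cell is cut out both by the open set `cellNhd` and by the
closed set `closedCell`; it is also convex, hence connected. -/
lemma connectedComponentIn_eq_openCell (h : Admissible ρ i j k l) {x : Fin N → ℝ}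
    (hx : x ∈ openCell ρ i j k l) :
    connectedComponentIn (regularPoints (minTwice ρ)) x = openCell ρ i j k l := by
  have hsub := openCell_subset_regularPoints h
  refine subset_antisymm ?_
    (convex_openCell.isPreconnected.subset_connectedComponentIn hx hsub)
  have hR := connectedComponentIn_subset (regularPoints (minTwice ρ)) x
  have hinter : regularPoints (minTwice ρ) ∩ cellNhd ρ i j k l ⊆ openCell ρ i j k l :=
    fun y hy => minTwice_inter_cellNhd h ▸ ⟨hy.1.1, hy.2⟩
  have hcover : connectedComponentIn (regularPoints (minTwice ρ)) x ⊆
      cellNhd ρ i j k l ∪ (closedCell ρ i j k l)ᶜ := by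
    intro y hy
    by_cases hyc : y ∈ closedCell ρ i j k l
    · exact Or.inl (regularPoints_inter_closedCell_subset h ⟨hR hy, hyc⟩).2.2
    · exact Or.inr hyc
  have hdisj : connectedComponentIn (regularPoints (minTwice ρ)) x ∩
      (cellNhd ρ i j k l ∩ (closedCell ρ i j k l)ᶜ) = ∅ :=
    Set.eq_empty_of_forall_notMem fun y hy =>
      hy.2.2 (openCell_subset_closedCell (hinter ⟨hR hy.1, hy.2.1⟩))
  rcases isPreconnected_iff_subset_of_disjoint.1 isPreconnected_connectedComponentIn
    _ _ isOpen_cellNhd isClosed_closedCell.isOpen_compl hcover hdisj with h' | h'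
  · exact fun y hy => hinter ⟨hR hy, h' hy⟩
  · exact absurd (openCell_subset_closedCell hx) (h' (mem_connectedComponentIn (hsub hx)))

/-- Two global minima in one class give a pair cell at once. If two lie in different classes, a
global minimum in a third class gives type I; otherwise removing each class in turn yields two
global minima in the other, hence type III. -/
lemma exists_closedCell_of_mem_minTwice [Nontrivial κ] (hN : 0 < N) {a : Fin N → ℝ}
    (ha : a ∈ minTwice ρ) : ∃ i j k l, Admissible ρ i j k l ∧ a ∈ closedCell ρ i j k l := by
  have : Nonempty (Fin N) := ⟨⟨0, hN⟩⟩
  obtain ⟨i₀, hi₀⟩ := Finite.exists_min a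
  obtain ⟨c₀, hc₀⟩ := exists_ne (ρ i₀)
  obtain ⟨i, j, hij, -, -, hr⟩ := ha c₀
  have hi : ∀ r, a i ≤ a r ∧ a j ≤ a r := fun r => by
    have := hi₀ r; have := hr i₀ hc₀.symm; grind
  obtain ⟨k, l, hkl, hk, hl, hr⟩ := ha (ρ i)
  by_cases hij' : ρ i = ρ j
  · refine ⟨i, j, k, l, ⟨by grind, by grind, by grind, hij, hkl, Or.inr hij'⟩, ?_, ?_,
      fun s t hst => ?_⟩
    · exact le_antisymm (hi _).1 (hi _).2
    · exact le_antisymm (hr l hl).1 (hr k hk).2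
    · rcases hst with hst | hst
      · grind
      · have := hr t (by grind); grind
  have triple : ∀ q, ρ q ≠ ρ i → ρ q ≠ ρ j → (∀ r, a q ≤ a r) →
      ∃ i j k l, Admissible ρ i j k l ∧ a ∈ closedCell ρ i j k l := by
    intro q hqi hqj hq
    refine ⟨i, j, q, j, ⟨by grind, by grind, by grind, hij, by grind, Or.inl rfl⟩, ?_, ?_,
      fun s t hst => ?_⟩
    · exact le_antisymm (hi _).1 (hi _).2
    · exact le_antisymm (hq _) (hi _).2
    · rcases hst with hst | hst <;> grind
  have hkm : ∀ r, a k ≤ a r ∧ a l ≤ a r := fun r => by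
    have := hr j (by grind); have := hi r; grind
  by_cases hkj : ρ k = ρ j
  swap
  · exact triple k hk hkj fun r => (hkm r).1
  by_cases hlj : ρ l = ρ j
  swap
  · exact triple l hl hlj fun r => (hkm r).2
  obtain ⟨k', l', hkl', hk', hl', hr'⟩ := ha (ρ j)
  have hkm' : ∀ r, a k' ≤ a r ∧ a l' ≤ a r := fun r => by
    have := hr' i (by grind); have := hi r; grind
  by_cases hki : ρ k' = ρ i
  swap
  · exact triple k' hki hk' fun r => (hkm' r).1
  by_cases hli : ρ l' = ρ i
  swap
  · exact triple l' hli hl' fun r => (hkm' r).2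
  refine ⟨k', l', k, l, ⟨by grind, by grind, by grind, hkl', hkl, Or.inr (by grind)⟩, ?_, ?_,
    fun s t hst => ?_⟩
  · exact le_antisymm (hkm' _).1 (hkm' _).2
  · exact le_antisymm (hkm _).1 (hkm _).2
  · rcases hst with hst | hst <;> grind

lemma isClosed_minTwice : IsClosed (minTwice ρ) := by
  have : minTwice ρ = ⋂ c, ⋃ i, ⋃ j, {_a | i ≠ j ∧ ρ i ≠ c ∧ ρ j ≠ c} ∩
      ⋂ r, ⋂ _ : ρ r ≠ c, {a : Fin N → ℝ | a i ≤ a r} ∩ {a | a j ≤ a r} := by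
    ext a; simp [minTwice, and_assoc]
  rw [this]
  refine isClosed_iInter fun c => isClosed_iUnion_of_finite fun i =>
    isClosed_iUnion_of_finite fun j => isClosed_const.inter ?_
  exact isClosed_iInter fun r => isClosed_iInter fun _ =>
    (isClosed_le (by fun_prop) (by fun_prop)).inter (isClosed_le (by fun_prop) (by fun_prop))

lemma openCell_nonempty (h : Admissible ρ i j k l) : (openCell ρ i j k l).Nonempty := by
  obtain ⟨ik, jk, li, ij, kl, hor⟩ := h
  -- In types I and III no two of the four indices are compared, so one level suffices. Type II
  -- needs `i`, `j` strictly below `k`, `l`.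
  by_cases hjl : j = l ∨ ρ k = ρ l
  · refine ⟨fun r => if r = i ∨ r = j ∨ r = k ∨ r = l then -1 else 0, ?_, ?_, fun s t hst => ?_⟩
    · simp
    · simp
    · have hs : s = i ∨ s = j ∨ s = k ∨ s = l := by rcases hst with hst | hst <;> grind
      have ht : ¬ (t = i ∨ t = j ∨ t = k ∨ t = l) := by rcases hst with hst | hst <;> grind
      simp only [if_pos hs, if_neg ht]
      norm_num
  · refine ⟨fun r => if r = i ∨ r = j then -2 else if r = k ∨ r = l then -1 else 0,
      ?_, ?_, fun s t hst => ?_⟩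
    · simp
    · grind
    · rcases hst with hst | hst <;> grind

lemma isFacet_closedCell (h : Admissible ρ i j k l) :
    IsFacet (minTwice ρ) (closedCell ρ i j k l) := by
  obtain ⟨x, hx⟩ := openCell_nonempty h
  exact ⟨x, openCell_subset_regularPoints h hx, by
    rw [connectedComponentIn_eq_openCell h hx, closure_openCell ⟨x, hx⟩]⟩

lemma isFacet_minTwice_iff [Nontrivial κ] (hN : 0 < N) {F : Set (Fin N → ℝ)} :
    IsFacet (minTwice ρ) F ↔ ∃ i j k l, Admissible ρ i j k l ∧ F = closedCell ρ i j k l := by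
  constructor
  · rintro ⟨x, hx, rfl⟩
    obtain ⟨i, j, k, l, h, hc⟩ := exists_closedCell_of_mem_minTwice hN hx.1
    have hxo := regularPoints_inter_closedCell_subset h ⟨hx, hc⟩
    exact ⟨i, j, k, l, h, by
      rw [connectedComponentIn_eq_openCell h hxo, closure_openCell ⟨x, hxo⟩]⟩
  · rintro ⟨i, j, k, l, h, rfl⟩
    exact isFacet_closedCell h

end Cells

/-! ### The tropical linear space of polynomials with a double root -/

section Valuation

/-! ### Valuations of sums and of prime field elements; density of the value group. -/

lemma AddValuation.map_sum_eq_of_lt {K ι : Type*} [Field K] (v : AddValuation K (WithTop ℝ))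
    {s : Finset ι} {f : ι → K} {j : ι} {g : ℝ} (hj : j ∈ s) (hv : v (f j) = g)
    (h : ∀ r ∈ s, r ≠ j → (g : WithTop ℝ) < v (f r)) : v (∑ r ∈ s, f r) = g := by
  classical
  rw [← Finset.add_sum_erase s f hj, ← hv]
  refine v.map_add_eq_of_lt_left ?_
  rw [hv]
  exact v.map_lt_sum WithTop.coe_ne_top fun r hr =>
    h r (Finset.mem_of_mem_erase hr) (Finset.ne_of_mem_erase hr)

variable {p : ℕ} {K : Type u} [Field K] (v : AddValuation K (WithTop ℝ))

lemma AddValuation.eq_zero_of_pow_eq_one {x : K} {n : ℕ} (hn : n ≠ 0) (hx : x ^ n = 1) :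
    v x = 0 := by
  have hx0 : x ≠ 0 := by rintro rfl; simp [hn] at hx
  have h := congrArg v hx
  rw [v.map_pow, v.map_one] at h
  lift v x to ℝ using (v.ne_top_iff).2 hx0 with r
  have h' : n • r = 0 := by exact_mod_cast h
  simpa [hn] using h'

lemma AddValuation.map_castHom_eq_zero [Fact p.Prime] [CharP K p] {x : ZMod p} (hx : x ≠ 0) :
    v (ZMod.castHom dvd_rfl K x) = 0 := by
  refine v.eq_zero_of_pow_eq_one (n := p - 1) ?_ ?_
  · have := (Fact.out : p.Prime).two_le; omega
  · rw [← _root_.map_pow, ZMod.pow_card_sub_one_eq_one hx, _root_.map_one]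

/-- Roots of an element of positive value `g` have value `g / n`, so the value group contains all
integer multiples of arbitrarily small steps. -/
lemma AddValuation.exists_map_mem_Ioo [IsAlgClosed K] (hv : ∃ x : K, x ≠ 0 ∧ v x ≠ 0)
    {α β : ℝ} (h : α < β) : ∃ (y : K) (r : ℝ), v y = r ∧ α < r ∧ r < β := by
  obtain ⟨x, hx0, g, hg, hxg⟩ : ∃ x : K, x ≠ 0 ∧ ∃ g : ℝ, 0 < g ∧ v x = g := by
    obtain ⟨x, hx0, hx⟩ := hv
    obtain ⟨g, hg⟩ := WithTop.ne_top_iff_exists.1 ((v.ne_top_iff).2 hx0)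
    have hg0 : g ≠ 0 := by rintro rfl; exact hx hg.symm
    rcases lt_or_gt_of_ne hg0 with h | h
    · refine ⟨x⁻¹, inv_ne_zero hx0, -g, by linarith, ?_⟩
      have h1 : v x + v x⁻¹ = 0 := by rw [← v.map_mul, mul_inv_cancel₀ hx0, v.map_one]
      obtain ⟨g', hg'⟩ := WithTop.ne_top_iff_exists.1 ((v.ne_top_iff).2 (inv_ne_zero hx0))
      rw [← hg, ← hg'] at h1
      have h2 : g + g' = 0 := by exact_mod_cast h1
      rw [← hg', show g' = -g by linarith]
    · exact ⟨x, hx0, g, h, hg.symm⟩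
  obtain ⟨n, hn⟩ := exists_nat_gt (g / (β - α))
  have hβα : 0 < β - α := sub_pos.2 h
  have hn0 : (0 : ℝ) < n := lt_of_le_of_lt (by positivity) hn
  have hn0' : 0 < n := by exact_mod_cast hn0
  obtain ⟨z, hz⟩ := IsAlgClosed.exists_pow_nat_eq x hn0'
  have hz0 : z ≠ 0 := by rintro rfl; exact hx0 (by rw [← hz, zero_pow hn0'.ne'])
  have hvz : v z = (g / n : ℝ) := by
    obtain ⟨r, hr⟩ := WithTop.ne_top_iff_exists.1 ((v.ne_top_iff).2 hz0)
    have h1 := congrArg v hz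
    rw [v.map_pow, hxg, ← hr] at h1
    have h2 : n • r = g := by exact_mod_cast h1
    rw [← hr]
    congr 1
    rw [nsmul_eq_mul] at h2
    field_simp
    linarith
  set d := g / n
  have hd : 0 < d := by positivity
  have hdlt : d < β - α := by
    rw [div_lt_iff₀ hβα] at hn
    rw [div_lt_iff₀ hn0]; linarith
  have hzpow : ∀ q : ℤ, v (z ^ q) = ((q * d : ℝ) : WithTop ℝ) := by
    have hnat : ∀ q : ℕ, v (z ^ q) = ((q * d : ℝ) : WithTop ℝ) := fun q => by
      rw [v.map_pow, hvz, ← WithTop.coe_nsmul, nsmul_eq_mul]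
    intro q
    obtain ⟨q, rfl | rfl⟩ := q.eq_nat_or_neg
    · simpa using hnat q
    · have h0 : z ^ (-(q : ℤ)) ≠ 0 := zpow_ne_zero _ hz0
      have h1 : v (z ^ q) + v (z ^ (-(q : ℤ))) = 0 := by
        rw [← v.map_mul, zpow_neg, zpow_natCast, mul_inv_cancel₀ (pow_ne_zero _ hz0), v.map_one]
      obtain ⟨g', hg'⟩ := WithTop.ne_top_iff_exists.1 ((v.ne_top_iff).2 h0)
      rw [hnat, ← hg'] at h1
      have h2 : q * d + g' = 0 := by exact_mod_cast h1
      rw [← hg']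
      congr 1
      push_cast; linarith
  refine ⟨z ^ (⌊α / d⌋ + 1), _, hzpow _, ?_, ?_⟩
  · rw [← div_lt_iff₀ hd]; push_cast; exact Int.lt_floor_add_one _
  · have := Int.floor_le (α / d)
    rw [le_div_iff₀ hd] at this
    push_cast; linarith

variable (p) in
/-- The residue of the exponent of a monomial. -/
def residue {N : ℕ} (i : Fin N) : ZMod p := ((i : ℕ) : ZMod p)

/-- The valuations of the vectors of the plane of codimension two whose tropicalization is
`tropDoubleRoot v m`. -/
def valuationVectors (m : ℕ) : Set (Fin (m + 1) → ℝ) :=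
  {a | ∃ x : Fin (m + 1) → K, (∀ i, v (x i) = ((a i : ℝ) : WithTop ℝ)) ∧
    ∑ i, x i = 0 ∧ ∑ i : Fin (m + 1), ((i : ℕ) : K) * x i = 0}

lemma tropDoubleRoot_eq_closure (m : ℕ) :
    tropDoubleRoot v m = closure (valuationVectors v m) := by
  unfold tropDoubleRoot
  congr 1
  ext a
  constructor
  · rintro ⟨F, hF, hv, B, hB, h1, h2⟩
    have hsum : F = ∑ i : Fin (m + 1), C (F.coeff i) * X ^ (i : ℕ) := by
      rw [Fin.sum_univ_eq_sum_range (fun i => C (F.coeff i) * X ^ i)]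
      exact F.as_sum_range_C_mul_X_pow' (by omega)
    have e1 : F.eval B = ∑ i : Fin (m + 1), F.coeff i * B ^ (i : ℕ) := by
      conv_lhs => rw [hsum]
      simp [eval_finsetSum]
    -- Multiplying by `B` turns `i B ^ (i - 1)` into `i B ^ i`, including for `i = 0`, where the
    -- subtraction truncates.
    have e2 : (derivative F).eval B * B =
        ∑ i : Fin (m + 1), ((i : ℕ) : K) * (F.coeff i * B ^ (i : ℕ)) := by
      conv_lhs => rw [hsum]
      rw [derivative_sum, eval_finsetSum, Finset.sum_mul]
      refine Finset.sum_congr rfl fun i _ => ?_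
      rw [derivative_C_mul_X_pow, eval_C_mul, eval_pow, eval_X]
      rcases Nat.eq_zero_or_pos (i : ℕ) with h0 | h0
      · simp [h0]
      · rw [mul_assoc, pow_sub_one_mul h0.ne']; ring
    refine ⟨fun i => F.coeff i * B ^ (i : ℕ), fun i => ?_, ?_, ?_⟩
    · rw [v.map_mul, v.map_pow, hB, smul_zero, add_zero, hv]
    · rw [← e1]; exact h1
    · rw [← e2, h2.eq_zero, zero_mul]
  · rintro ⟨x, hv, h1, h2⟩
    have hcoeff : ∀ j : Fin (m + 1),
        (∑ i : Fin (m + 1), C (x i) * X ^ (i : ℕ)).coeff j = x j := fun j => by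
      simp [finsetSum_coeff, coeff_C_mul, coeff_X_pow, Fin.val_inj]
    refine ⟨∑ i : Fin (m + 1), C (x i) * X ^ (i : ℕ), ?_, fun j => ?_, 1, v.map_one, ?_, ?_⟩
    · refine natDegree_eq_of_le_of_coeff_ne_zero ?_ ?_
      · refine natDegree_sum_le_of_forall_le _ _ fun i _ => ?_
        exact (natDegree_C_mul_X_pow_le _ _).trans (by omega)
      · have := hcoeff (Fin.last m)
        rw [Fin.val_last] at this
        rw [this, ← v.ne_top_iff, hv]
        exact WithTop.coe_ne_top
    · rw [hcoeff, hv]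
    · simpa [IsRoot, eval_finsetSum] using h1
    · rw [IsRoot, derivative_sum, eval_finsetSum, ← h2]
      exact Finset.sum_congr rfl fun i _ => by
        rw [derivative_C_mul_X_pow, eval_C_mul, eval_pow, eval_X, one_pow, mul_one, mul_comm]

lemma sum_castHom_sub_mul [Fact p.Prime] [CharP K p] {m : ℕ} (x : Fin (m + 1) → K) (c : ZMod p) :
    ∑ i : Fin (m + 1), ZMod.castHom dvd_rfl K (residue p i - c) * x i =
      ∑ i : Fin (m + 1), ((i : ℕ) : K) * x i - ZMod.castHom dvd_rfl K c * ∑ i, x i := by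
  simp only [map_sub, sub_mul, Finset.sum_sub_distrib, Finset.mul_sum, residue, map_natCast]

lemma valuationVectors_subset_minTwice [Fact p.Prime] [CharP K p] {m : ℕ} (hm : 1 ≤ m) :
    valuationVectors v m ⊆ minTwice (residue p) := by
  rintro a ⟨x, hv, h1, h2⟩ c
  have hsum := sum_castHom_sub_mul x c
  rw [h1, h2, mul_zero, sub_zero] at hsum
  have hne : (Finset.univ.filter fun i : Fin (m + 1) => residue p i ≠ c).Nonempty := by
    by_cases hc : c = 0
    · exact ⟨⟨1, by omega⟩, by simp [residue, hc]⟩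
    · exact ⟨⟨0, by omega⟩, Finset.mem_filter.2 ⟨Finset.mem_univ _, by simpa [residue] using Ne.symm hc⟩⟩
  obtain ⟨i, hi, hmin⟩ := Finset.exists_min_image _ a hne
  simp only [Finset.mem_filter, Finset.mem_univ, true_and] at hi hmin
  by_contra hcon
  push Not at hcon
  have hterm : ∀ r, residue p r ≠ c →
      v (ZMod.castHom dvd_rfl K (residue p r - c) * x r) = ((a r : ℝ) : WithTop ℝ) := fun r hr => by
    rw [v.map_mul, v.map_castHom_eq_zero (sub_ne_zero.2 hr), zero_add, hv]
  have := v.map_sum_eq_of_lt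
    (f := fun r => ZMod.castHom dvd_rfl K (residue p r - c) * x r) (Finset.mem_univ i) (hterm i hi) fun r _ hri => ?_
  · rw [hsum, v.map_zero] at this
    exact WithTop.top_ne_coe this
  · by_cases hr : residue p r = c
    · rw [hr, sub_self, map_zero, zero_mul, v.map_zero]; exact WithTop.coe_lt_top _
    · rw [hterm r hr]
      obtain ⟨q, hq, hlt⟩ := hcon i r (Ne.symm hri) hi hr
      exact WithTop.coe_lt_coe.2 ((hmin q hq).trans_lt (hlt (hmin q hq)))

/-- In the equation for `c`, the term at `l` strictly dominates the rest once `k` is removed, so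
solving for coordinate `k` gives valuation `b l = b k`. -/
lemma exists_coordinate [Fact p.Prime] [CharP K p] {N : ℕ} {b : Fin N → ℝ} {y : Fin N → K}
    (hy : ∀ r, v (y r) = ((b r : ℝ) : WithTop ℝ)) {c : ZMod p} {k l : Fin N} (hkl : k ≠ l)
    (hk : residue p k ≠ c) (hl : residue p l ≠ c) (hb : b k = b l)
    (h : ∀ r, residue p r ≠ c → r ≠ k → r ≠ l → b k < b r) :
    ∃ z : K, v z = ((b k : ℝ) : WithTop ℝ) ∧ ZMod.castHom dvd_rfl K (residue p k - c) * z +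
      ∑ r ∈ Finset.univ.erase k, ZMod.castHom dvd_rfl K (residue p r - c) * y r = 0 := by
  set S := ∑ r ∈ Finset.univ.erase k, ZMod.castHom dvd_rfl K (residue p r - c) * y r with hS
  have hterm : ∀ r, residue p r ≠ c →
      v (ZMod.castHom dvd_rfl K (residue p r - c) * y r) = ((b r : ℝ) : WithTop ℝ) := fun r hr => by
    rw [v.map_mul, v.map_castHom_eq_zero (sub_ne_zero.2 hr), zero_add, hy]
  have hvS : v S = ((b k : ℝ) : WithTop ℝ) := by
    refine v.map_sum_eq_of_lt (j := l) (by simp [hkl.symm]) (by rw [hterm l hl, hb]) ?_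
    intro r hr hrl
    by_cases hrc : residue p r = c
    · rw [hrc, sub_self, map_zero, zero_mul, v.map_zero]; exact WithTop.coe_lt_top _
    · rw [hterm r hrc]
      exact WithTop.coe_lt_coe.2 (h r hrc (Finset.ne_of_mem_erase hr) hrl)
  have hd : residue p k - c ≠ 0 := sub_ne_zero.2 hk
  refine ⟨ZMod.castHom dvd_rfl K (residue p k - c)⁻¹ * -S, ?_, ?_⟩
  · rw [v.map_mul, v.map_castHom_eq_zero (inv_ne_zero hd), zero_add, v.map_neg, hvS]
  · rw [← mul_assoc, ← map_mul, mul_inv_cancel₀ hd, map_one, one_mul, neg_add_cancel]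

lemma mem_valuationVectors_of_mem_openCell [Fact p.Prime] [CharP K p] {m : ℕ}
    {i j k l : Fin (m + 1)} (h : Admissible (residue p) i j k l) {b : Fin (m + 1) → ℝ}
    (hb : b ∈ openCell (residue p) i j k l) {y : Fin (m + 1) → K}
    (hy : ∀ r, v (y r) = ((b r : ℝ) : WithTop ℝ)) : b ∈ valuationVectors v m := by
  classical
  obtain ⟨ik, jk, li, ij, kl, hor⟩ := h
  obtain ⟨h1, h2, h3⟩ := hb
  have hik : i ≠ k := by rintro rfl; exact ik rfl
  obtain ⟨z, hz, ez⟩ := exists_coordinate v hy kl ik.symm li h2 fun r hr hrk hrl =>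
    h3 k r (Or.inr ⟨Or.inl rfl, hrk, hrl, hr⟩)
  obtain ⟨w, hw, ew⟩ := exists_coordinate v hy ij ik jk h1 fun r hr hri hrj =>
    h3 i r (Or.inl ⟨Or.inl rfl, hri, hrj, hr⟩)
  set x : Fin (m + 1) → K := Function.update (Function.update y k z) i w with hx
  have xk : x k = z := by simp [hx, hik.symm]
  have xi : x i = w := by simp [hx]
  have xr : ∀ r, r ≠ i → r ≠ k → x r = y r := fun r hi hk => by simp [hx, hi, hk]
  -- Overwriting coordinate `i` does not disturb this equation, whose coefficient at `i` is zero;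
  -- the same holds for `k` in `e2`.
  have e1 : ∑ r, ZMod.castHom dvd_rfl K (residue p r - residue p i) * x r = 0 := by
    rw [← Finset.add_sum_erase _ _ (Finset.mem_univ k), xk, ← ez]
    congr 1
    refine Finset.sum_congr rfl fun r hr => ?_
    by_cases hri : r = i
    · simp [hri]
    · rw [xr r hri (Finset.ne_of_mem_erase hr)]
  have e2 : ∑ r, ZMod.castHom dvd_rfl K (residue p r - residue p k) * x r = 0 := by
    rw [← Finset.add_sum_erase _ _ (Finset.mem_univ i), xi, ← ew]
    congr 1
    refine Finset.sum_congr rfl fun r hr => ?_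
    by_cases hrk : r = k
    · simp [hrk]
    · rw [xr r (Finset.ne_of_mem_erase hr) hrk]
  rw [sum_castHom_sub_mul] at e1 e2
  have hinj := (ZMod.castHom dvd_rfl K : ZMod p →+* K).injective
  have hs : ∑ r, x r = 0 := by
    have : (ZMod.castHom dvd_rfl K (residue p k) - ZMod.castHom dvd_rfl K (residue p i)) *
        ∑ r, x r = 0 := by linear_combination e1 - e2
    exact (mul_eq_zero.1 this).resolve_left (sub_ne_zero.2 fun h => ik (hinj h).symm)
  refine ⟨x, fun r => ?_, hs, ?_⟩
  · by_cases hri : r = i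
    · rw [hri, xi, hw]
    · by_cases hrk : r = k
      · rw [hrk, xk, hz]
      · rw [xr r hri hrk, hy]
  · rw [hs] at e1; simpa using e1

lemma openCell_subset_closure_valuationVectors [Fact p.Prime] [CharP K p] [IsAlgClosed K]
    (hv : ∃ x : K, x ≠ 0 ∧ v x ≠ 0) {m : ℕ} {i j k l : Fin (m + 1)}
    (h : Admissible (residue p) i j k l) :
    openCell (residue p) i j k l ⊆ closure (valuationVectors v m) := by
  intro a ha
  refine Metric.mem_closure_iff.2 fun ε hε => ?_
  obtain ⟨δ, hδ, hball⟩ := Metric.isOpen_iff.1 (isOpen_cellNhd (ρ := residue p)) a ha.2.2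
  -- The approximation is chosen as a function of the real value alone, so equal coordinates of `a`
  -- stay equal.
  have : ∀ t : ℝ, ∃ (y : K) (r : ℝ), v y = r ∧ dist r t < min ε δ := fun t => by
    have hmin : 0 < min ε δ := lt_min hε hδ
    obtain ⟨y, r, hy, h1, h2⟩ := v.exists_map_mem_Ioo hv
      (show t - min ε δ < t + min ε δ by linarith)
    exact ⟨y, r, hy, by rw [Real.dist_eq, abs_lt]; constructor <;> linarith⟩
  choose y φ hy hφ using this
  have hd : ∀ η, 0 < η → min ε δ ≤ η → dist (fun r => φ (a r)) a < η := fun η hη hle =>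
    (dist_pi_lt_iff hη).2 fun r => (hφ (a r)).trans_le hle
  refine ⟨fun r => φ (a r), ?_, by rw [dist_comm]; exact hd ε hε (min_le_left _ _)⟩
  refine mem_valuationVectors_of_mem_openCell v h ⟨?_, ?_, ?_⟩ fun r => hy (a r)
  · simp only [ha.1]
  · simp only [ha.2.1]
  · exact hball (hd δ hδ (min_le_right _ _))

lemma tropDoubleRoot_eq_minTwice [Fact p.Prime] [CharP K p] [IsAlgClosed K]
    (hv : ∃ x : K, x ≠ 0 ∧ v x ≠ 0) {m : ℕ} (hm : 1 ≤ m) :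
    tropDoubleRoot v m = minTwice (residue p) := by
  rw [tropDoubleRoot_eq_closure]
  refine (closure_minimal (valuationVectors_subset_minTwice v hm) isClosed_minTwice).antisymm ?_
  intro a ha
  obtain ⟨i, j, k, l, h, hc⟩ := exists_closedCell_of_mem_minTwice (Nat.succ_pos m) ha
  rw [← closure_openCell (openCell_nonempty h)] at hc
  exact closure_minimal (openCell_subset_closure_valuationVectors v hv h) isClosed_closure hc

lemma isFacet_tropDoubleRoot_iff [Fact p.Prime] [CharP K p] [IsAlgClosed K]
    (hv : ∃ x : K, x ≠ 0 ∧ v x ≠ 0) {m : ℕ} (hm : 1 ≤ m) {F : Set (Fin (m + 1) → ℝ)} :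
    IsFacet (tropDoubleRoot v m) F ↔
      ∃ i j k l, Admissible (residue p) i j k l ∧ F = closedCell (residue p) i j k l := by
  rw [tropDoubleRoot_eq_minTwice (p := p) v hv hm, isFacet_minTwice_iff (Nat.succ_pos m)]

end Valuation

/-! ### The three types of facets and their number -/

section Types

variable {p m : ℕ} {i j k l i' j' k' l' : Fin (m + 1)}

lemma residue_eq_iff : residue p i = residue p j ↔ (i : ℕ) ≡ j [MOD p] :=
  ZMod.natCast_eq_natCast_iff _ _ _

lemma tripleCell_eq_closedCell (hik : residue p i ≠ residue p k)
    (hjk : residue p j ≠ residue p k) : tripleCell i j k = closedCell (residue p) i j k j := by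
  ext a
  simp only [tripleCell, closedCell, Compared, Set.mem_ofPred_eq]
  constructor
  · intro h
    have := h i
    have := h j
    have := h k
    refine ⟨by grind, by grind, fun s t hst => ?_⟩
    have := h t
    grind
  · rintro ⟨h1, h2, h3⟩ r
    have := h3 i r
    have := h3 k r
    grind

/-- As `k` and `l` lie in different classes, the comparison of `i` with `l` gives `a i ≤ a l = a k`,
which makes `i`, `j` global minima. -/
lemma pairCell_eq_closedCell (hij : residue p i = residue p j) (hki : residue p k ≠ residue p i)
    (hli : residue p l ≠ residue p i) (hkl : residue p k ≠ residue p l) :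
    pairCell p i j k l = closedCell (residue p) i j k l := by
  ext a
  simp only [pairCell, closedCell, Compared, Set.mem_ofPred_eq, ← residue_eq_iff]
  constructor
  · rintro ⟨h, h'⟩
    have := h i
    have := h j
    have := h' k
    have := h' l
    refine ⟨by grind, by grind, fun s t hst => ?_⟩
    have := h t
    have := h' t
    grind
  · rintro ⟨h1, h2, h3⟩
    have h4 := h3 i l
    refine ⟨fun r => ?_, fun r => ?_⟩ <;>
    · have := h3 i r
      have := h3 k r
      grind

/-- Here the two pairs are not compared with each other, so the wall `a i = a k` is interior to the
cell and both orders belong to one facet. -/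
lemma pairCell_union_eq_closedCell (hij : residue p i = residue p j)
    (hkl : residue p k = residue p l) (hik : residue p i ≠ residue p k) :
    pairCell p i j k l ∪ pairCell p k l i j = closedCell (residue p) i j k l := by
  ext a
  simp only [pairCell, closedCell, Compared, Set.mem_ofPred_eq, Set.mem_union, ← residue_eq_iff]
  constructor
  · rintro (⟨h, h'⟩ | ⟨h, h'⟩) <;>
    · have := h i
      have := h j
      have := h k
      have := h l
      have := h' i
      have := h' j
      have := h' k
      have := h' l
      refine ⟨by grind, by grind, fun s t hst => ?_⟩
      have := h t
      have := h' t
      grind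
  · rintro ⟨h1, h2, h3⟩
    have h4 : ∀ r, residue p r ≠ residue p k → a i ≤ a r := fun r hr => by
      have := h3 i r
      grind
    have h5 : ∀ r, residue p r ≠ residue p i → a k ≤ a r := fun r hr => by
      have := h3 k r
      grind
    rcases le_total (a i) (a k) with h | h
    · left
      refine ⟨fun r => ?_, fun r => ?_⟩ <;>
      · have := h4 r
        have := h5 r
        grind
    · right
      refine ⟨fun r => ?_, fun r => ?_⟩ <;>
      · have := h4 r
        have := h5 r
        grind

lemma isType_iff_closedCell {F : Set (Fin (m + 1) → ℝ)} :
    (IsTypeI p F ∨ IsTypeII p F ∨ IsTypeIII p F) ↔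
      ∃ i j k l, Admissible (residue p) i j k l ∧ F = closedCell (residue p) i j k l := by
  simp only [IsTypeI, IsTypeII, IsTypeIII, ← residue_eq_iff]
  constructor
  · rintro (⟨i, j, k, hij, hik, hjk, rfl⟩ | ⟨i, j, k, l, hne, hij, hki, hli, hkl, rfl⟩ |
      ⟨i, j, k, l, hij, hkl, hij', hkl', hik, rfl⟩)
    · exact ⟨i, j, k, j, ⟨hik, hjk, Ne.symm hij, by grind, by grind, Or.inl rfl⟩,
        tripleCell_eq_closedCell hik hjk⟩
    · exact ⟨i, j, k, l, ⟨Ne.symm hki, by grind, hli, hne, by grind, Or.inr hij⟩,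
        pairCell_eq_closedCell hij hki hli hkl⟩
    · exact ⟨i, j, k, l, ⟨hik, by grind, by grind, hij, hkl, Or.inr hij'⟩,
        pairCell_union_eq_closedCell hij' hkl' hik⟩
  · rintro ⟨i, j, k, l, ⟨ik, jk, li, ij, kl, hor⟩, rfl⟩
    by_cases hij : residue p i = residue p j
    · by_cases hkl : residue p k = residue p l
      · exact Or.inr (Or.inr ⟨i, j, k, l, ij, kl, hij, hkl, ik,
          (pairCell_union_eq_closedCell hij hkl ik).symm⟩)
      · exact Or.inr (Or.inl ⟨i, j, k, l, ij, hij, ik.symm, li, hkl,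
          (pairCell_eq_closedCell hij ik.symm li hkl).symm⟩)
    · obtain rfl := hor.resolve_right hij
      exact Or.inl ⟨i, j, k, hij, ik, jk, (tripleCell_eq_closedCell ik jk).symm⟩

lemma tripleCell_comm_left : tripleCell i j k = tripleCell j i k := by
  ext a; simp only [tripleCell, Set.mem_ofPred_eq]; grind

lemma tripleCell_comm_right : tripleCell i j k = tripleCell i k j := by
  ext a; simp only [tripleCell, Set.mem_ofPred_eq]; grind

lemma pairCell_comm_left (h : (i : ℕ) ≡ j [MOD p]) : pairCell p i j k l = pairCell p j i k l := by
  ext a; simp only [pairCell, Set.mem_ofPred_eq, ← residue_eq_iff] at *; grind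

lemma pairCell_comm_right : pairCell p i j k l = pairCell p i j l k := by
  ext a; simp only [pairCell, Set.mem_ofPred_eq]; grind

lemma mem_of_tripleCell_subset (h : tripleCell i j k ⊆ tripleCell i' j' k') :
    (i' = i ∨ i' = j ∨ i' = k) ∧ (j' = i ∨ j' = j ∨ j' = k) ∧ (k' = i ∨ k' = j ∨ k' = k) := by
  have : (fun r => if r = i ∨ r = j ∨ r = k then -1 else 0 : Fin (m + 1) → ℝ) ∈
      tripleCell i j k := fun r => by grind
  have := h this i
  grind

/-- The point with value `-2` at `i`, `j`, value `-1` at `k`, `l`, and `0` elsewhere. -/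
def pairCellPoint (i j k l : Fin (m + 1)) : Fin (m + 1) → ℝ :=
  fun r => if r = i ∨ r = j then -2 else if r = k ∨ r = l then -1 else 0

lemma pairCellPoint_mem (hij : (i : ℕ) ≡ j [MOD p]) : pairCellPoint i j k l ∈ pairCell p i j k l := by
  simp only [pairCell, Set.mem_ofPred_eq, ← residue_eq_iff, pairCellPoint] at *
  grind

lemma mem_of_pairCellPoint_mem (h : pairCellPoint i j k l ∈ pairCell p i' j' k' l')
    (hij : (i : ℕ) ≡ j [MOD p]) (hki : ¬ (k : ℕ) ≡ i [MOD p])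
    (hk' : ¬ (k' : ℕ) ≡ i' [MOD p]) (hl' : ¬ (l' : ℕ) ≡ i' [MOD p]) :
    (i' = i ∨ i' = j) ∧ (j' = i ∨ j' = j) ∧ (k' = k ∨ k' = l) ∧ (l' = k ∨ l' = l) := by
  simp only [pairCell, Set.mem_ofPred_eq, ← residue_eq_iff, pairCellPoint] at *
  have h1 := h.1 i
  have h2 := h.2 k
  have h3 : (i' = i ∨ i' = j) ∧ (j' = i ∨ j' = j) := by grind
  have h4 : residue p i' = residue p i := by grind
  have h5 := h2 (by grind)
  grind

end Types

/-! ### Counting cells by normalized indices. -/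

section Counting

open Finset

/-- The increasing pairs of elements of `s`. -/
def increasingPairs {α : Type*} [LinearOrder α] (s : Finset α) : Finset (α × α) :=
  (s ×ˢ s).filter fun q => q.1 < q.2

/-- The increasing triples of elements of `s`. -/
def increasingTriples {α : Type*} [LinearOrder α] (s : Finset α) : Finset (α × α × α) :=
  (s ×ˢ s ×ˢ s).filter fun q => q.1 < q.2.1 ∧ q.2.1 < q.2.2

lemma card_increasingPairs {α : Type*} [LinearOrder α] (s : Finset α) :
    (increasingPairs s).card = s.card.choose 2 := by
  induction s using Finset.induction_on_max with
  | empty => simp [increasingPairs]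
  | insert a s h ih =>
    have ha : a ∉ s := fun h' => lt_irrefl _ (h a h')
    have heq : increasingPairs (insert a s) = increasingPairs s ∪ s ×ˢ {a} := by
      ext ⟨x, y⟩
      simp only [increasingPairs, mem_filter, mem_product, mem_insert, mem_union, mem_singleton]
      have := h x
      have := h y
      grind
    have hdisj : Disjoint (increasingPairs s) (s ×ˢ {a}) := by
      refine Finset.disjoint_left.2 ?_
      rintro ⟨x, y⟩
      simp only [increasingPairs, mem_filter, mem_product, mem_singleton]
      grind
    rw [heq, card_union_of_disjoint hdisj, ih, card_insert_of_notMem ha, card_product,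
      card_singleton, Nat.choose_succ_succ' _ 1, Nat.choose_one_right]
    ring

lemma card_increasingTriples {α : Type*} [LinearOrder α] (s : Finset α) :
    (increasingTriples s).card = s.card.choose 3 := by
  induction s using Finset.induction_on_max with
  | empty => simp [increasingTriples]
  | insert a s h ih =>
    have ha : a ∉ s := fun h' => lt_irrefl _ (h a h')
    have heq : increasingTriples (insert a s) = increasingTriples s ∪
        (increasingPairs s).image fun q => (q.1, q.2, a) := by
      ext ⟨x, y, z⟩
      simp only [increasingTriples, increasingPairs, mem_filter, mem_product, mem_insert,
        mem_union, mem_image, Prod.exists, Prod.mk.injEq]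
      have := h x
      have := h y
      have := h z
      grind
    have hdisj : Disjoint (increasingTriples s)
        ((increasingPairs s).image fun q => (q.1, q.2, a)) := by
      refine Finset.disjoint_left.2 ?_
      rintro ⟨x, y, z⟩
      simp only [increasingTriples, mem_filter, mem_product, mem_image, Prod.exists, Prod.mk.injEq]
      grind
    rw [heq, card_union_of_disjoint hdisj, ih, card_insert_of_notMem ha, card_image_of_injective,
      card_increasingPairs, Nat.choose_succ_succ' _ 2]
    · ring
    · rintro ⟨x, y⟩ ⟨x', y'⟩ h
      simpa using h

lemma encard_setOf_eq_card {α β : Type*} {s : Finset α} {g : α → β} {P : β → Prop}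
    (hinj : Set.InjOn g s) (hP : ∀ b, P b ↔ ∃ a ∈ s, g a = b) : {b | P b}.encard = s.card := by
  have : {b | P b} = g '' s := by ext b; simpa using hP b
  rw [this, hinj.encard_image, Set.encard_coe_eq_coe_finsetCard]

variable {p n m : ℕ} (e : Fin n × Fin p ≃ Fin (m + 1))

lemma encard_isTypeI (he : ∀ x y, (e x : ℕ) ≡ e y [MOD p] ↔ x.2 = y.2) :
    {F : Set (Fin (m + 1) → ℝ) | IsTypeI p F}.encard = ((p.choose 3 * n ^ 3 : ℕ) : ℕ∞) := by
  rw [encard_setOf_eq_card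
    -- The symmetry is removed by ordering the residues; the positions within the three classes are
    -- then free.
    (s := increasingTriples (univ : Finset (Fin p)) ×ˢ (univ : Finset (Fin n × Fin n × Fin n)))
    (g := fun q => tripleCell (e (q.2.1, q.1.1)) (e (q.2.2.1, q.1.2.1)) (e (q.2.2.2, q.1.2.2)))]
  · simp [card_increasingTriples]
    ring
  · rintro ⟨⟨r, s, t⟩, a, b, c⟩ h ⟨⟨r', s', t'⟩, a', b', c'⟩ h' heq
    have := mem_of_tripleCell_subset heq.le
    simp only [increasingTriples, coe_product, Set.mem_prod, mem_coe, mem_filter,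
      e.injective.eq_iff, Prod.mk.injEq] at *
    grind
  · intro F
    constructor
    · rintro ⟨i, j, k, hij, hik, hjk, rfl⟩
      obtain ⟨⟨a, r⟩, rfl⟩ := e.surjective i
      obtain ⟨⟨b, s⟩, rfl⟩ := e.surjective j
      obtain ⟨⟨c, t⟩, rfl⟩ := e.surjective k
      simp only [he] at hij hik hjk
      have key : ∀ (a b c : Fin n) (r s t : Fin p), r < s → s < t →
          ∃ q ∈ increasingTriples (univ : Finset (Fin p)) ×ˢ
            (univ : Finset (Fin n × Fin n × Fin n)),
          tripleCell (e (q.2.1, q.1.1)) (e (q.2.2.1, q.1.2.1)) (e (q.2.2.2, q.1.2.2)) =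
            tripleCell (e (a, r)) (e (b, s)) (e (c, t)) := fun a b c r s t h1 h2 =>
        ⟨((r, s, t), a, b, c), by simp [increasingTriples, h1, h2], rfl⟩
      rcases lt_or_gt_of_ne hij with h1 | h1 <;> rcases lt_or_gt_of_ne hik with h2 | h2 <;>
        rcases lt_or_gt_of_ne hjk with h3 | h3
      · exact key _ _ _ _ _ _ h1 h3
      · rw [tripleCell_comm_right]; exact key _ _ _ _ _ _ h2 h3
      · exact absurd (h1.trans h3) h2.not_gt
      · rw [tripleCell_comm_right, tripleCell_comm_left]; exact key _ _ _ _ _ _ h2 h1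
      · rw [tripleCell_comm_left]; exact key _ _ _ _ _ _ h1 h2
      · exact absurd (h3.trans h1) h2.not_gt
      · rw [tripleCell_comm_left, tripleCell_comm_right]; exact key _ _ _ _ _ _ h3 h2
      · rw [tripleCell_comm_left, tripleCell_comm_right, tripleCell_comm_left]
        exact key _ _ _ _ _ _ h3 h1
    · rintro ⟨⟨⟨r, s, t⟩, a, b, c⟩, h, rfl⟩
      simp only [increasingTriples, mem_product, mem_filter, mem_univ, true_and, and_true] at h
      exact ⟨_, _, _, by rw [he]; exact h.1.ne, by rw [he]; exact (h.1.trans h.2).ne,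
        by rw [he]; exact h.2.ne, rfl⟩

lemma encard_isTypeII (he : ∀ x y, (e x : ℕ) ≡ e y [MOD p] ↔ x.2 = y.2) :
    {F : Set (Fin (m + 1) → ℝ) | IsTypeII p F}.encard =
      ((p * n ^ 2 * n.choose 2 * (p - 1).choose 2 : ℕ) : ℕ∞) := by
  rw [encard_setOf_eq_card
    (s := (univ.sigma fun r : Fin p => increasingPairs ({r}ᶜ : Finset (Fin p))) ×ˢ
      increasingPairs (univ : Finset (Fin n)) ×ˢ (univ : Finset (Fin n × Fin n)))
    (g := fun q => pairCell p (e (q.2.1.1, q.1.1)) (e (q.2.1.2, q.1.1))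
      (e (q.2.2.1, q.1.2.1)) (e (q.2.2.2, q.1.2.2)))]
  · simp [card_increasingPairs, card_compl]
    ring
  · rintro ⟨⟨r, s, t⟩, ⟨a, b⟩, c, d⟩ h ⟨⟨r', s', t'⟩, ⟨a', b'⟩, c', d'⟩ h' heq
    simp only [increasingPairs, coe_product, coe_sigma, Set.mem_prod, Set.mem_sigma_iff, mem_coe,
      mem_filter, mem_product, mem_compl, mem_singleton] at h h'
    have h1 : pairCellPoint (e (a, r)) (e (b, r)) (e (c, s)) (e (d, t)) ∈
        pairCell p (e (a', r')) (e (b', r')) (e (c', s')) (e (d', t')) :=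
      heq.le (pairCellPoint_mem (by simp [he]))
    have h2 := mem_of_pairCellPoint_mem h1 (by simp [he]) (by rw [he]; grind) (by rw [he]; grind)
      (by rw [he]; grind)
    simp only [e.injective.eq_iff, Prod.mk.injEq] at h2
    have : r = r' ∧ s = s' ∧ t = t' ∧ a = a' ∧ b = b' ∧ c = c' ∧ d = d' := by grind
    obtain ⟨rfl, rfl, rfl, rfl, rfl, rfl, rfl⟩ := this
    rfl
  · intro F
    constructor
    · rintro ⟨i, j, k, l, hne, hij, hki, hli, hkl, rfl⟩
      obtain ⟨⟨a, r⟩, rfl⟩ := e.surjective i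
      obtain ⟨⟨b, r'⟩, rfl⟩ := e.surjective j
      obtain ⟨⟨c, s⟩, rfl⟩ := e.surjective k
      obtain ⟨⟨d, t⟩, rfl⟩ := e.surjective l
      have hij' := hij
      simp only [he, e.injective.ne_iff] at hij hki hli hkl hne
      subst hij
      have hab : a ≠ b := by rintro rfl; exact hne rfl
      have key : ∀ (a b c d : Fin n) (s t : Fin p), a < b → s < t → s ≠ r → t ≠ r →
          ∃ q ∈ (univ.sigma fun r : Fin p => increasingPairs ({r}ᶜ : Finset (Fin p))) ×ˢ
            increasingPairs (univ : Finset (Fin n)) ×ˢ (univ : Finset (Fin n × Fin n)),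
          pairCell p (e (q.2.1.1, q.1.1)) (e (q.2.1.2, q.1.1))
            (e (q.2.2.1, q.1.2.1)) (e (q.2.2.2, q.1.2.2)) =
          pairCell p (e (a, r)) (e (b, r)) (e (c, s)) (e (d, t)) :=
        fun a b c d s t h1 h2 h3 h4 =>
          ⟨(⟨r, s, t⟩, (a, b), c, d), by simp [increasingPairs, h1, h2, h3, h4], rfl⟩
      rcases lt_or_gt_of_ne hab with h1 | h1 <;> rcases lt_or_gt_of_ne hkl with h2 | h2
      · exact key _ _ _ _ _ _ h1 h2 hki hli
      · rw [pairCell_comm_right]; exact key _ _ _ _ _ _ h1 h2 hli hki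
      · rw [pairCell_comm_left hij']; exact key _ _ _ _ _ _ h1 h2 hki hli
      · rw [pairCell_comm_left hij', pairCell_comm_right]
        exact key _ _ _ _ _ _ h1 h2 hli hki
    · rintro ⟨⟨⟨r, s, t⟩, ⟨a, b⟩, c, d⟩, h, rfl⟩
      simp only [increasingPairs, mem_product, mem_sigma, mem_filter, mem_univ, true_and,
        and_true, mem_compl, mem_singleton] at h
      refine ⟨_, _, _, _, ?_, by simp [he], ?_, ?_, ?_, rfl⟩
      · rw [e.injective.ne_iff]; grind
      all_goals rw [he]; grind

lemma encard_isTypeIII (he : ∀ x y, (e x : ℕ) ≡ e y [MOD p] ↔ x.2 = y.2) :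
    {F : Set (Fin (m + 1) → ℝ) | IsTypeIII p F}.encard =
      ((p.choose 2 * n.choose 2 ^ 2 : ℕ) : ℕ∞) := by
  rw [encard_setOf_eq_card
    (s := increasingPairs (univ : Finset (Fin p)) ×ˢ increasingPairs (univ : Finset (Fin n)) ×ˢ
      increasingPairs (univ : Finset (Fin n)))
    (g := fun q => pairCell p (e (q.2.1.1, q.1.1)) (e (q.2.1.2, q.1.1))
        (e (q.2.2.1, q.1.2)) (e (q.2.2.2, q.1.2)) ∪
      pairCell p (e (q.2.2.1, q.1.2)) (e (q.2.2.2, q.1.2))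
        (e (q.2.1.1, q.1.1)) (e (q.2.1.2, q.1.1)))]
  · simp [card_increasingPairs]
    ring
  · rintro ⟨⟨r, s⟩, ⟨a, b⟩, c, d⟩ h ⟨⟨r', s'⟩, ⟨a', b'⟩, c', d'⟩ h' heq
    simp only [increasingPairs, coe_product, Set.mem_prod, mem_coe, mem_filter] at h h'
    have h1 := heq.le (Or.inl (pairCellPoint_mem (i := e (a, r)) (j := e (b, r))
      (k := e (c, s)) (l := e (d, s)) (by simp [he])))
    have h2 : (a = a' ∧ b = b' ∧ c = c' ∧ d = d' ∧ r = r' ∧ s = s') := by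
      -- In the second case the residues would be exchanged, contradicting `r < s` and `r' < s'`.
      rcases h1 with h1 | h1
      all_goals
        have h2 := mem_of_pairCellPoint_mem h1 (by simp [he]) (by rw [he]; grind)
          (by rw [he]; grind) (by rw [he]; grind)
        simp only [e.injective.eq_iff, Prod.mk.injEq] at h2
        grind
    grind
  · intro F
    constructor
    · rintro ⟨i, j, k, l, hne, hne', hij, hkl, hik, rfl⟩
      obtain ⟨⟨a, r⟩, rfl⟩ := e.surjective i
      obtain ⟨⟨b, r'⟩, rfl⟩ := e.surjective j
      obtain ⟨⟨c, s⟩, rfl⟩ := e.surjective k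
      obtain ⟨⟨d, s'⟩, rfl⟩ := e.surjective l
      have hij' := hij
      have hkl' := hkl
      simp only [he, e.injective.ne_iff] at hij hkl hik hne hne'
      subst hij hkl
      have hab : a ≠ b := by rintro rfl; exact hne rfl
      have hcd : c ≠ d := by rintro rfl; exact hne' rfl
      have key : ∀ (a b c d : Fin n) (r s : Fin p), a < b → c < d → r ≠ s →
          ∃ q ∈ increasingPairs (univ : Finset (Fin p)) ×ˢ
            increasingPairs (univ : Finset (Fin n)) ×ˢ increasingPairs (univ : Finset (Fin n)),
          pairCell p (e (q.2.1.1, q.1.1)) (e (q.2.1.2, q.1.1))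
            (e (q.2.2.1, q.1.2)) (e (q.2.2.2, q.1.2)) ∪
          pairCell p (e (q.2.2.1, q.1.2)) (e (q.2.2.2, q.1.2))
            (e (q.2.1.1, q.1.1)) (e (q.2.1.2, q.1.1)) =
          pairCell p (e (a, r)) (e (b, r)) (e (c, s)) (e (d, s)) ∪
            pairCell p (e (c, s)) (e (d, s)) (e (a, r)) (e (b, r)) := by
        intro a b c d r s h1 h2 h3
        rcases lt_or_gt_of_ne h3 with h3 | h3
        · exact ⟨((r, s), (a, b), c, d), by simp [increasingPairs, h1, h2, h3], rfl⟩
        · exact ⟨((s, r), (c, d), a, b), by simp [increasingPairs, h1, h2, h3],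
            Set.union_comm _ _⟩
      have swap : ∀ {a b : Fin n} {r : Fin p} {k l : Fin (m + 1)},
          pairCell p (e (a, r)) (e (b, r)) k l ∪ pairCell p k l (e (a, r)) (e (b, r)) =
          pairCell p (e (b, r)) (e (a, r)) k l ∪ pairCell p k l (e (b, r)) (e (a, r)) := by
        intro a b r k l
        rw [pairCell_comm_left (by simp [he]), pairCell_comm_right (i := k)]
      rcases lt_or_gt_of_ne hab with h1 | h1 <;> rcases lt_or_gt_of_ne hcd with h2 | h2
      · exact key _ _ _ _ _ _ h1 h2 hik
      · rw [Set.union_comm, swap, Set.union_comm]; exact key _ _ _ _ _ _ h1 h2 hik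
      · rw [swap]; exact key _ _ _ _ _ _ h1 h2 hik
      · rw [swap, Set.union_comm, swap, Set.union_comm]; exact key _ _ _ _ _ _ h1 h2 hik
    · rintro ⟨⟨⟨r, s⟩, ⟨a, b⟩, c, d⟩, h, rfl⟩
      simp only [increasingPairs, mem_product, mem_filter, mem_univ, true_and, and_true] at h
      refine ⟨_, _, _, _, ?_, ?_, by simp [he], by simp [he], ?_, rfl⟩
      · rw [e.injective.ne_iff]; grind
      · rw [e.injective.ne_iff]; grind
      · rw [he]; grind

lemma exists_monomialEquiv (hp : 0 < p) (hn : 1 ≤ n) :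
    ∃ e : Fin n × Fin p ≃ Fin (p * n - 1 + 1), ∀ x y, (e x : ℕ) ≡ e y [MOD p] ↔ x.2 = y.2 := by
  have h : n * p = p * n - 1 + 1 := by
    have := Nat.mul_pos hp hn
    rw [mul_comm]; omega
  refine ⟨finProdFinEquiv.trans (finCongr h), fun x y => ?_⟩
  simp [Nat.ModEq, Nat.mod_eq_of_lt, Fin.ext_iff]

lemma encard_setOf_closedCell_le {κ : Type*} {N : ℕ} (ρ : Fin N → κ) :
    {F | ∃ i j k l, Admissible ρ i j k l ∧ F = closedCell ρ i j k l}.encard ≤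
      ((N ^ 4 : ℕ) : ℕ∞) := by
  have hsub : {F | ∃ i j k l, Admissible ρ i j k l ∧ F = closedCell ρ i j k l} ⊆
      (fun q : Fin N × Fin N × Fin N × Fin N => closedCell ρ q.1 q.2.1 q.2.2.1 q.2.2.2) ''
        Set.univ := by
    rintro F ⟨i, j, k, l, -, rfl⟩
    exact ⟨(i, j, k, l), Set.mem_univ _, rfl⟩
  refine (Set.encard_le_encard hsub).trans ((Set.encard_image_le _ _).trans ?_)
  simp only [Set.encard_univ, ENat.card_eq_coe_fintype_card, Fintype.card_prod, Fintype.card_fin]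
  exact_mod_cast (by ring_nf; rfl)

end Counting

theorem mainTheorem3 (p : ℕ) (hp : p.Prime) (hp2 : 2 < p) :
    (∀ (K : Type u) [Field K] [IsAlgClosed K] [CharP K p] (v : AddValuation K (WithTop ℝ)),
      (∃ x : K, x ≠ 0 ∧ v x ≠ 0) → ∀ n : ℕ, 1 ≤ n →
        (∀ F, IsFacet (tropDoubleRoot v (p * n - 1)) F →
          IsTypeI p F ∨ IsTypeII p F ∨ IsTypeIII p F) ∧
        {F | IsFacet (tropDoubleRoot v (p * n - 1)) F ∧ IsTypeI p F}.encard
          = ((p.choose 3 * n ^ 3 : ℕ) : ℕ∞) ∧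
        {F | IsFacet (tropDoubleRoot v (p * n - 1)) F ∧ IsTypeII p F}.encard
          = ((p * n ^ 2 * n.choose 2 * (p - 1).choose 2 : ℕ) : ℕ∞) ∧
        {F | IsFacet (tropDoubleRoot v (p * n - 1)) F ∧ IsTypeIII p F}.encard
          = ((p.choose 2 * n.choose 2 ^ 2 : ℕ) : ℕ∞)) ∧
    (∃ C : ℕ, ∀ (K : Type u) [Field K] [IsAlgClosed K] [CharP K p]
      (v : AddValuation K (WithTop ℝ)), (∃ x : K, x ≠ 0 ∧ v x ≠ 0) → ∀ m : ℕ, 1 ≤ m →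
        {F | IsFacet (tropDoubleRoot v m) F}.encard ≤ ((C * m ^ 4 : ℕ) : ℕ∞)) := by
  have : Fact p.Prime := ⟨hp⟩
  -- The constant `16` comes from at most `(m + 1) ^ 4` index quadruples and `m + 1 ≤ 2 * m`.
  refine ⟨fun K _ _ _ v hv n hn => ?_, 16, fun K _ _ _ v hv m hm => ?_⟩
  · have hm : 1 ≤ p * n - 1 := by
      have := Nat.mul_le_mul hp2.le hn
      omega
    have hF : ∀ F, IsFacet (tropDoubleRoot v (p * n - 1)) F ↔
        IsTypeI p F ∨ IsTypeII p F ∨ IsTypeIII p F := fun F => by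
      rw [isFacet_tropDoubleRoot_iff (p := p) v hv hm, isType_iff_closedCell]
    obtain ⟨e, he⟩ := exists_monomialEquiv hp.pos hn
    refine ⟨fun F => (hF F).1, ?_, ?_, ?_⟩
    · rw [← encard_isTypeI e he]
      congr 1; ext F; simp only [hF, Set.mem_ofPred_eq]; tauto
    · rw [← encard_isTypeII e he]
      congr 1; ext F; simp only [hF, Set.mem_ofPred_eq]; tauto
    · rw [← encard_isTypeIII e he]
      congr 1; ext F; simp only [hF, Set.mem_ofPred_eq]; tauto
  · simp only [isFacet_tropDoubleRoot_iff (p := p) v hv hm]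
    refine (encard_setOf_closedCell_le _).trans ?_
    norm_cast
    calc (m + 1) ^ 4 ≤ (2 * m) ^ 4 := Nat.pow_le_pow_left (by omega) 4
      _ = 16 * m ^ 4 := by ring
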